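/- Let $G$ be a finite multigraph (parallel edges and self-loops allowed) with vertex set $V$, $|V|=n$, and edge set $E$. The vertices are agents and the edges are indivisible goods. Each agent $i$ has a valuation $v_i\colon 2^E\to\mathbb{R}_{\ge 0}$ which is normalized ($v_i(\emptyset)=0$), monotone, XOS (the pointwise maximum of finitely many additive set functions) and graphical: $v_i(S\cup\{e\})=v_i(S)$ for all $S\subseteq E$ whenever $e$ is not incident to $i$. Put $d=\lceil 8\sqrt n\,\rceil$ and let $$\mu_i^d=\max_{(P_1,\dots,P_d)}\ \min_{1\le t\le d} v_i(P_t),$$ the maximum being over all partitions of $E$ into $d$ (possibly empty) parts. For each agent $i$ let $(\hat P_{i,1},\dots,\hat P_{i,d})$ be an arbitrary partition attaining this maximum, and let $B_{i,t}$ be the set of edges of $\hat P_{i,t}$ that are incident to $i$ (the canonical bundles of $i$). Then there is a frugal $\tfrac23$-out-of-$\lceil 8\sqrt n\,\rceil$ MMS orientation: there are pairwise disjoint sets $X_i\subseteq E$ $(i\in V)$, where $X_i$ contains only edges incident to $i$, such that for every agent $i$ we have $X_i\subseteq B_{i,t_i}$ for some $t_i\in\{1,\dots,d\}$ and $v_i(X_i)\ge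 \tfrac23\,\mu_i^d$. (The $X_i$ need not cover $E$.) Moreover, these sets can be enlarged to an orientation of all edges: there are pairwise disjoint $Y_i\supseteq X_i$ with $\bigcup_{i} Y_i=E$, where $Y_i$ contains only edges incident to $i$, and $v_i(Y_i)\ge\tfrac23\,\mu_i^d$ for every agent $i$. -/

import Mathlib

open scoped Graph

namespace FairGraph

/-! ### Valuations on subsets of a set of items -/

section Valuations

variable {I : Type*}

/-- A set function with nonnegative values that is normalized and monotone (nonnegativity follows
from the two conditions). -/
def IsValuation (v : Finset I → ℝ) : Prop :=
  v ∅ = 0 ∧ ∀ S T : Finset I, S ⊆ T → v S ≤ v T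

/-- `a` is additive: the value of a set is the sum of the values of its items. -/
def IsAdditive (a : Finset I → ℝ) : Prop :=
  ∀ S : Finset I, a S = ∑ g ∈ S, a {g}

/-- `v` is XOS (fractionally subadditive): it is the pointwise maximum of finitely many additive
functions. -/
def IsXOS (v : Finset I → ℝ) : Prop :=
  ∃ (k : ℕ) (a : Fin k → Finset I → ℝ), (∀ l, IsAdditive (a l)) ∧
    ∀ S : Finset I, IsGreatest (Set.range fun l => a l S) (v S)

open Classical in
/-- Adding the item `e` to a set never changes its value. -/
def IsIrrelevant (v : Finset I → ℝ) (e : I) : Prop :=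
  ∀ S : Finset I, v (insert e S) = v S

/-! ### Partitions into `d` parts and maximin shares -/

/-- `P` is a partition of the set of all items into `d` (possibly empty) labelled parts. -/
def IsPartition {d : ℕ} (P : Fin d → Finset I) : Prop :=
  (∀ s t, s ≠ t → Disjoint (P s) (P t)) ∧ ∀ e : I, ∃ t, e ∈ P t

/-- The value under `v` of the worst part of `P`. -/
noncomputable def minPart {d : ℕ} (v : Finset I → ℝ) (P : Fin d → Finset I) : ℝ :=
  ⨅ t, v (P t)

/-- The `1`-out-of-`d` maximin share of `v`: the maximum, over all partitions of the items into
`d` parts, of the value of the worst part. -/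
noncomputable def maximinShare (v : Finset I → ℝ) (d : ℕ) : ℝ :=
  ⨆ P : {P : Fin d → Finset I // IsPartition P}, minPart v P.1

/-- `P` is a `1`-out-of-`d` MMS partition for `v`: a partition into `d` parts that maximizes the
value of the worst part. -/
def IsMMSPartition {d : ℕ} (v : Finset I → ℝ) (P : Fin d → Finset I) : Prop :=
  IsPartition P ∧ ∀ Q : Fin d → Finset I, IsPartition Q → minPart v Q ≤ minPart v P

end Valuations

/-! ### The graphical model: agents are the vertices, items are the edges of a multigraph -/

section Graphical

variable {α β : Type*}

/-- The valuations `v` are graphical: an edge is relevant at most to its end vertices. -/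
def IsGraphical (G : Graph α β) (v : V(G) → Finset E(G) → ℝ) : Prop :=
  ∀ (i : V(G)) (e : E(G)), ¬ G.Inc e i → IsIrrelevant (v i) e

open Classical in
/-- The canonical bundle of agent `i` obtained from a part `S` of her fixed MMS partition: the
edges of `S` that are incident to `i`. -/
noncomputable def canonicalBundle (G : Graph α β) (i : V(G)) (S : Finset E(G)) : Finset E(G) :=
  S.filter fun e => G.Inc e i

/-- `X` is a (possibly partial) allocation of the edges: no edge is given to two agents. -/
def IsAllocation (G : Graph α β) (X : V(G) → Finset E(G)) : Prop :=
  ∀ i j, i ≠ j → Disjoint (X i) (X j)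

/-- `X` is a partial orientation: an allocation that gives edges only to their end vertices. -/
def IsPartialOrientation (G : Graph α β) (X : V(G) → Finset E(G)) : Prop :=
  IsAllocation G X ∧ ∀ i, ∀ e ∈ X i, G.Inc e i

/-- `X` is an orientation (of all edges): every edge is given to one of its end vertices. -/
def IsOrientation (G : Graph α β) (X : V(G) → Finset E(G)) : Prop :=
  IsPartialOrientation G X ∧ ∀ e : E(G), ∃ i, e ∈ X i

/-- `X` is frugal with respect to the canonical bundles obtained from the partitions `P i`: every
agent gets a subset of a single one of her canonical bundles. -/
def IsFrugal (G : Graph α β) {d : ℕ} (P : V(G) → Fin d → Finset E(G))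
    (X : V(G) → Finset E(G)) : Prop :=
  ∀ i, ∃ t, X i ⊆ canonicalBundle G i (P i t)

/-- `X` is `c`-out-of-`d` MMS: every agent gets at least a `c` fraction of her `1`-out-of-`d`
maximin share. -/
def IsOutOfMMS (G : Graph α β) (v : V(G) → Finset E(G) → ℝ) (c : ℝ) (d : ℕ)
    (X : V(G) → Finset E(G)) : Prop :=
  ∀ i, c * maximinShare (v i) d ≤ v i (X i)

end Graphical

end FairGraph

namespace FairGraph

/-! ### Random transversals that avoid conflicts -/

section Transversals

open Finset

set_option linter.unusedSectionVars false

variable {ι κ : Type*} [Fintype ι] [Fintype κ] [DecidableEq ι] [DecidableEq κ]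

/-! Pick one canonical bundle per agent. An XOS supporting function turns the overlap of bundles `p`
and `q` into a fraction `ω p q` of the value of `p`. An edge has at most two ends, so these overlaps
are disjoint and the fractions sum to at most 1. Each overlap is denied to the owner with the
smaller fraction, so it suffices to choose bundles for which every agent loses at most 1/3
(`exists_selection`). With `d` bundles per agent and `n` agents, few bundles (`d ≤ 21`) make `3n ≤
d`, and averaging the total loss is enough. Otherwise a second moment is needed. Selections
containing two bundles that each lose more than 1/5 to the other are excluded;
`card_conflictFree_insert`, a counting form of the local lemma, shows that this inflates the
probability of fixing three coordinates by at most (4/3)^3. The off-diagonal products of losses,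
totalled over all agents, then average at most (64/27) n/d² ≤ 1/27, and since each single loss is at
most 1/5, this bounds every agent's loss (`sum_le_third_of_sum_mul_le`). -/

/-- Fixing a coordinate on which a family of functions does not depend divides its size by the
number of values. -/
lemma card_filter_apply_eq_mul (A : Finset (ι → κ)) (i : ι)
    (hA : ∀ τ ∈ A, ∀ s, Function.update τ i s ∈ A) (t : κ) :
    #{τ ∈ A | τ i = t} * Fintype.card κ = #A := by
  have h : ∀ s : κ, #{τ ∈ A | τ i = s} = #{τ ∈ A | τ i = t} := by
    intro s
    refine card_nbij' (fun τ => Function.update τ i t) (fun τ => Function.update τ i s)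
      ?_ ?_ ?_ ?_
    · intro τ hτ
      simp only [coe_filter, Set.mem_ofPred_eq] at hτ ⊢
      exact ⟨hA τ hτ.1 t, by simp⟩
    · intro τ hτ
      simp only [coe_filter, Set.mem_ofPred_eq] at hτ ⊢
      exact ⟨hA τ hτ.1 s, by simp⟩
    · intro τ hτ
      simp only [coe_filter, Set.mem_ofPred_eq] at hτ
      simp [← hτ.2]
    · intro τ hτ
      simp only [coe_filter, Set.mem_ofPred_eq] at hτ
      simp [← hτ.2]
  have hA' : #A = ∑ s : κ, #{τ ∈ A | τ i = s} :=
    card_eq_sum_card_fiberwise (f := fun τ : ι → κ => τ i) (t := univ) (fun _ _ => by simp)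
  rw [hA', sum_congr rfl fun s _ => h s]
  simp [mul_comm]

lemma card_filter_apply_eq_two_mul (A : Finset (ι → κ)) {i j : ι} (hij : i ≠ j)
    (hi : ∀ τ ∈ A, ∀ s, Function.update τ i s ∈ A)
    (hj : ∀ τ ∈ A, ∀ s, Function.update τ j s ∈ A) (t s : κ) :
    #{τ ∈ A | τ i = t ∧ τ j = s} * Fintype.card κ ^ 2 = #A := by
  rw [← card_filter_apply_eq_mul A i hi t, ← card_filter_apply_eq_mul {τ ∈ A | τ i = t} j
    (fun τ hτ r => by
      rw [mem_filter] at hτ ⊢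
      exact ⟨hj τ hτ.1 r, by rw [Function.update_of_ne hij]; exact hτ.2⟩) s, filter_filter]
  ring

lemma card_filter_apply_eq_three_mul (A : Finset (ι → κ)) {i j k : ι} (hij : i ≠ j)
    (hik : i ≠ k) (hjk : j ≠ k)
    (hi : ∀ τ ∈ A, ∀ s, Function.update τ i s ∈ A)
    (hj : ∀ τ ∈ A, ∀ s, Function.update τ j s ∈ A)
    (hk : ∀ τ ∈ A, ∀ s, Function.update τ k s ∈ A) (t s r : κ) :
    #{τ ∈ A | τ i = t ∧ τ j = s ∧ τ k = r} * Fintype.card κ ^ 3 = #A := by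
  rw [← card_filter_apply_eq_mul A i hi t, ← card_filter_apply_eq_two_mul {τ ∈ A | τ i = t} hjk
    (fun τ hτ r => by
      rw [mem_filter] at hτ ⊢
      exact ⟨hj τ hτ.1 r, by rw [Function.update_of_ne hij]; exact hτ.2⟩)
    (fun τ hτ r => by
      rw [mem_filter] at hτ ⊢
      exact ⟨hk τ hτ.1 r, by rw [Function.update_of_ne hik]; exact hτ.2⟩) s r, filter_filter]
  ring

/-- If every fibre of `g` has at most `C` elements, then sums over `g` are at most `C` times the
sum over the codomain. -/
lemma sum_comp_le_of_card_fiber_le {σ γ : Type*} [Fintype γ] [DecidableEq γ] (A : Finset σ)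
    (g : σ → γ) (F : γ → ℝ) (hF : ∀ c, 0 ≤ F c) (C : ℝ)
    (hC : ∀ c, (#{τ ∈ A | g τ = c} : ℝ) ≤ C) :
    ∑ τ ∈ A, F (g τ) ≤ C * ∑ c, F c := by
  rw [← sum_fiberwise A g, mul_sum]
  refine sum_le_sum fun c _ => ?_
  rw [sum_congr rfl (g := fun _ => F c) fun τ hτ => by rw [(mem_filter.1 hτ).2], sum_const,
    nsmul_eq_mul]
  exact mul_le_mul_of_nonneg_right (hC c) (hF c)

/-- The functions whose values on `S` are free of conflicts. -/
def conflictFree (H : ι × κ → ι × κ → Prop) [DecidableRel H] (S : Finset ι) : Finset (ι → κ) :=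
  {τ | ∀ i ∈ S, ∀ j ∈ S, ¬ H (i, τ i) (j, τ j)}

lemma mem_conflictFree {H : ι × κ → ι × κ → Prop} [DecidableRel H] {S : Finset ι} {τ : ι → κ} :
    τ ∈ conflictFree H S ↔ ∀ i ∈ S, ∀ j ∈ S, ¬ H (i, τ i) (j, τ j) := by
  simp [conflictFree]

lemma conflictFree_anti (H : ι × κ → ι × κ → Prop) [DecidableRel H] {S T : Finset ι}
    (h : S ⊆ T) : conflictFree H T ⊆ conflictFree H S := fun τ hτ => by
  rw [mem_conflictFree] at hτ ⊢
  exact fun i hi j hj => hτ i (h hi) j (h hj)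

lemma update_mem_conflictFree {H : ι × κ → ι × κ → Prop} [DecidableRel H] {S : Finset ι} {i : ι}
    (hi : i ∉ S) : ∀ τ ∈ conflictFree H S, ∀ s, Function.update τ i s ∈ conflictFree H S := by
  intro τ hτ s
  rw [mem_conflictFree] at hτ ⊢
  intro j hj k hk
  rw [Function.update_of_ne (ne_of_mem_of_not_mem hj hi),
    Function.update_of_ne (ne_of_mem_of_not_mem hk hi)]
  exact hτ j hj k hk

/-- Requiring one more coordinate to be free of conflicts costs at most a factor `3 / 4` when the
conflict degree is at most `3 / 16` of the number of values. -/
lemma card_conflictFree_insert (H : ι × κ → ι × κ → Prop) [DecidableRel H]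
    (hsymm : ∀ p q, H p q → H q p) (hirr : ∀ p q, H p q → p.1 ≠ q.1) (D : ℕ)
    (hdeg : ∀ p, #{q | H p q} ≤ D) (hD : 16 * D ≤ 3 * Fintype.card κ) (S : Finset ι) :
    ∀ i ∉ S, 3 / 4 * (#(conflictFree H S) : ℝ) ≤ #(conflictFree H (insert i S)) := by
  induction S using Finset.strongInduction with
  | H S ih =>
  intro i hi
  rcases isEmpty_or_nonempty κ with hκ | hκ
  · have : IsEmpty (ι → κ) := ⟨fun τ => hκ.elim (τ i)⟩
    simp [Finset.eq_empty_of_isEmpty]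
  have hd : (0 : ℝ) < Fintype.card κ := by exact_mod_cast Fintype.card_pos
  set N : ℝ := (#(conflictFree H S) : ℝ) with hN
  set d : ℝ := (Fintype.card κ : ℝ) with hdd
  let E : Finset (κ × (ι × κ)) := {x | x.2.1 ∈ S ∧ H (i, x.1) x.2}
  -- Dropping the constraints at the conflicting coordinate makes both it and `i` free, so fixing
  -- the two values costs exactly a factor `d ^ 2`.
  let Bad : κ × (ι × κ) → Finset (ι → κ) := fun x =>
    {τ ∈ conflictFree H (S.erase x.2.1) | τ i = x.1 ∧ τ x.2.1 = x.2.2}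
  have hcover : conflictFree H S ⊆ conflictFree H (insert i S) ∪ E.biUnion Bad := by
    intro τ hτ
    rw [mem_union]
    by_contra! hcon
    refine hcon.1 (mem_conflictFree.2 ?_)
    have key : ∀ j ∈ S, ¬ H (i, τ i) (j, τ j) := fun j hj hH => hcon.2 <| mem_biUnion.2
      ⟨(τ i, (j, τ j)), by simp [E, hj, hH], by
        simpa [Bad] using conflictFree_anti H (erase_subset j S) hτ⟩
    intro j hj k hk hH
    rcases mem_insert.1 hj with rfl | hjS <;> rcases mem_insert.1 hk with rfl | hkS
    · exact hirr _ _ hH rfl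
    · exact key k hkS hH
    · exact key j hjS (hsymm _ _ hH)
    · exact mem_conflictFree.1 hτ j hjS k hkS hH
  have hE : (#E : ℝ) ≤ d * D := by
    have : #E ≤ Fintype.card κ * D := by
      have h1 : #E = ∑ t : κ, #{x ∈ E | x.1 = t} :=
        card_eq_sum_card_fiberwise (f := fun x : κ × (ι × κ) => x.1) (t := univ)
          (fun _ _ => by simp)
      rw [h1]
      refine (sum_le_card_nsmul univ _ D fun t _ => ?_).trans (by simp)
      refine le_trans (card_le_card_of_injOn Prod.snd ?_ ?_) (hdeg (i, t))
      · rintro ⟨a, q⟩ hx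
        simp only [coe_filter, Set.mem_ofPred_eq, E, mem_filter, mem_univ, true_and] at hx ⊢
        rw [← hx.2]
        exact hx.1.2
      · rintro ⟨a, q⟩ hx ⟨a', q'⟩ hx' h
        simp only [coe_filter, Set.mem_ofPred_eq] at hx hx' h
        rw [hx.2, hx'.2, h]
    rw [hdd]
    exact_mod_cast this
  have hBad : ∀ x ∈ E, (#(Bad x) : ℝ) ≤ 4 / 3 * N / d ^ 2 := by
    rintro ⟨t, j, s⟩ hx
    simp only [E, mem_filter, mem_univ, true_and] at hx
    have hij : i ≠ j := fun h => hi (h ▸ hx.1)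
    have h1 := card_filter_apply_eq_two_mul (conflictFree H (S.erase j)) hij
      (update_mem_conflictFree fun h => hi (mem_of_mem_erase h))
      (update_mem_conflictFree (notMem_erase j S)) t s
    -- The induction hypothesis, read backwards: releasing `j` enlarges the family by at most 4/3.
    have h2 := ih (S.erase j) (erase_ssubset hx.1) j (notMem_erase j S)
    rw [insert_erase hx.1] at h2
    have h1' : (#(Bad (t, j, s)) : ℝ) * d ^ 2 = #(conflictFree H (S.erase j)) := by
      rw [hdd]
      exact_mod_cast h1
    rw [le_div_iff₀ (by positivity), h1']
    linarith
  have hsum : N ≤ #(conflictFree H (insert i S)) + ∑ x ∈ E, (#(Bad x) : ℝ) := by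
    have := (card_le_card hcover).trans ((card_union_le _ _).trans
      (Nat.add_le_add_left card_biUnion_le _))
    rw [hN]
    exact_mod_cast this
  have hN0 : 0 ≤ N := by positivity
  have hs : ∑ x ∈ E, (#(Bad x) : ℝ) ≤ 1 / 4 * N := by
    calc ∑ x ∈ E, (#(Bad x) : ℝ) ≤ #E * (4 / 3 * N / d ^ 2) := by
          rw [← nsmul_eq_mul]; exact sum_le_card_nsmul _ _ _ hBad
      _ ≤ d * D * (4 / 3 * N / d ^ 2) := by gcongr
      _ = D / d * (4 / 3 * N) := by field_simp
      _ ≤ 3 / 16 * (4 / 3 * N) := by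
          refine mul_le_mul_of_nonneg_right ?_ (by positivity)
          rw [div_le_iff₀ hd]
          have : (16 : ℝ) * D ≤ 3 * d := by rw [hdd]; exact_mod_cast hD
          linarith
      _ = 1 / 4 * N := by ring
  linarith

/-- If there are at least three times as many values as coordinates, then some function has only
small losses, by averaging their total over all functions. -/
lemma exists_forall_sum_le_of_three_mul_card_le (ρ : ι × κ → ι × κ → ℝ)
    (hρ : ∀ p q, 0 ≤ ρ p q) (hirr : ∀ i t s, ρ (i, t) (i, s) = 0) (hsum : ∀ p, ∑ q, ρ p q ≤ 1)
    (hn : 3 * Fintype.card ι ≤ Fintype.card κ) (hne : Nonempty (ι → κ)) :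
    ∃ τ : ι → κ, ∀ i, ∑ j, ρ (i, τ i) (j, τ j) ≤ 1 / 3 := by
  rcases isEmpty_or_nonempty ι with hι | ⟨⟨i₀⟩⟩
  · exact ⟨hne.some, fun i => hι.elim i⟩
  have hκ : Nonempty κ := ⟨hne.some i₀⟩
  have hd : (0 : ℝ) < Fintype.card κ := by exact_mod_cast Fintype.card_pos
  set d : ℝ := (Fintype.card κ : ℝ) with hdd
  set N : ℝ := (#(univ : Finset (ι → κ)) : ℝ) with hN
  have hpair : ∀ i j, ∑ τ : ι → κ, ρ (i, τ i) (j, τ j) ≤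
      N / d ^ 2 * ∑ t, ∑ s, ρ (i, t) (j, s) := by
    intro i j
    by_cases hij : i = j
    · subst hij
      simp [hirr]
    have := sum_comp_le_of_card_fiber_le (univ : Finset (ι → κ)) (fun τ => (τ i, τ j))
      (fun c => ρ (i, c.1) (j, c.2)) (fun c => hρ _ _) (N / d ^ 2) (fun c => by
        have h := card_filter_apply_eq_two_mul (univ : Finset (ι → κ)) hij
          (fun _ _ _ => mem_univ _) (fun _ _ _ => mem_univ _) c.1 c.2
        rw [le_div_iff₀ (by positivity)]
        simp only [Prod.ext_iff]
        rw [hdd, hN]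
        exact le_of_eq (by exact_mod_cast h))
    simpa only [Fintype.sum_prod_type] using this
  have htotal : ∑ τ : ι → κ, ∑ i, ∑ j, ρ (i, τ i) (j, τ j) ≤ ∑ τ : ι → κ, (1 / 3 : ℝ) := by
    calc ∑ τ : ι → κ, ∑ i, ∑ j, ρ (i, τ i) (j, τ j)
        = ∑ i, ∑ j, ∑ τ : ι → κ, ρ (i, τ i) (j, τ j) := by
          rw [sum_comm]
          exact sum_congr rfl fun i _ => sum_comm
      _ ≤ ∑ i, ∑ j, N / d ^ 2 * ∑ t, ∑ s, ρ (i, t) (j, s) :=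
          sum_le_sum fun i _ => sum_le_sum fun j _ => hpair i j
      _ = N / d ^ 2 * ∑ i, ∑ t, ∑ q, ρ (i, t) q := by
          simp only [← mul_sum, Fintype.sum_prod_type]
          congr 1
          exact sum_congr rfl fun i _ => sum_comm
      _ ≤ N / d ^ 2 * ∑ i : ι, ∑ t : κ, 1 := by
          gcongr with i _ t _
          exact hsum _
      _ = N * (Fintype.card ι / d) := by
          simp only [sum_const, card_univ, nsmul_eq_mul, mul_one, ← hdd]
          field_simp
      _ ≤ N * (1 / 3) := by
          refine mul_le_mul_of_nonneg_left ?_ (by positivity)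
          rw [div_le_iff₀ hd]
          have : (3 : ℝ) * Fintype.card ι ≤ d := by rw [hdd]; exact_mod_cast hn
          linarith
      _ = ∑ τ : ι → κ, (1 / 3 : ℝ) := by simp [hN]
  obtain ⟨τ, -, hτ⟩ := exists_le_of_sum_le univ_nonempty htotal
  exact ⟨τ, fun i => (single_le_sum (f := fun i => ∑ j, ρ (i, τ i) (j, τ j))
    (fun i _ => sum_nonneg fun j _ => hρ _ _) (mem_univ i)).trans hτ⟩

lemma card_conflictFree_erase (H : ι × κ → ι × κ → Prop) [DecidableRel H]
    (hsymm : ∀ p q, H p q → H q p) (hirr : ∀ p q, H p q → p.1 ≠ q.1) (D : ℕ)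
    (hdeg : ∀ p, #{q | H p q} ≤ D) (hD : 16 * D ≤ 3 * Fintype.card κ) (S : Finset ι) (i : ι)
    (hi : i ∈ S) :
    3 / 4 * (#(conflictFree H (S.erase i)) : ℝ) ≤ #(conflictFree H S) := by
  simpa [insert_erase hi] using
    card_conflictFree_insert H hsymm hirr D hdeg hD (S.erase i) i (notMem_erase i S)

lemma conflictFree_nonempty (H : ι × κ → ι × κ → Prop) [DecidableRel H]
    (hsymm : ∀ p q, H p q → H q p) (hirr : ∀ p q, H p q → p.1 ≠ q.1) (D : ℕ)
    (hdeg : ∀ p, #{q | H p q} ≤ D) (hD : 16 * D ≤ 3 * Fintype.card κ)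
    (hne : Nonempty (ι → κ)) (S : Finset ι) : (conflictFree H S).Nonempty := by
  induction S using Finset.induction_on with
  | empty => exact ⟨hne.some, by simp [mem_conflictFree]⟩
  | insert i S hi ih =>
    have h := card_conflictFree_insert H hsymm hirr D hdeg hD S i hi
    have h0 : (0 : ℝ) < #(conflictFree H S) := by exact_mod_cast ih.card_pos
    have : (0 : ℝ) < #(conflictFree H (insert i S)) := by linarith
    exact card_pos.1 (by exact_mod_cast this)

/-- Some conflict-free function has a small sum of products of pairs of losses of one agent. -/
lemma exists_conflictFree_sum_le (H : ι × κ → ι × κ → Prop) [DecidableRel H]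
    (hsymm : ∀ p q, H p q → H q p) (hirrH : ∀ p q, H p q → p.1 ≠ q.1) (D : ℕ)
    (hdeg : ∀ p, #{q | H p q} ≤ D) (hD : 16 * D ≤ 3 * Fintype.card κ)
    (ρ : ι × κ → ι × κ → ℝ)
    (hρ : ∀ p q, 0 ≤ ρ p q) (hirr : ∀ i t s, ρ (i, t) (i, s) = 0) (hsum : ∀ p, ∑ q, ρ p q ≤ 1)
    (hn : 64 * Fintype.card ι ≤ Fintype.card κ ^ 2) (hne : Nonempty (ι → κ)) :
    ∃ τ ∈ conflictFree H (univ : Finset ι), ∀ i,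
      ∑ j, ∑ k, (if j = k then 0 else ρ (i, τ i) (j, τ j) * ρ (i, τ i) (k, τ k)) ≤ 1 / 27 := by
  rcases isEmpty_or_nonempty ι with hι | ⟨⟨i₀⟩⟩
  · exact ⟨hne.some, by simp [mem_conflictFree], fun i => hι.elim i⟩
  have hκ : Nonempty κ := ⟨hne.some i₀⟩
  have hd : (0 : ℝ) < Fintype.card κ := by exact_mod_cast Fintype.card_pos
  set d : ℝ := (Fintype.card κ : ℝ) with hdd
  set A := conflictFree H (univ : Finset ι) with hA
  set N : ℝ := (#A : ℝ) with hN
  have hN0 : 0 ≤ N := by positivity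
  have hAne : A.Nonempty := conflictFree_nonempty H hsymm hirrH D hdeg hD hne univ
  -- 64/27 = (4/3)^3: one factor for each of the three released coordinates.
  set C : ℝ := 64 / 27 * N / d ^ 3 with hC
  have hC0 : 0 ≤ C := by positivity
  have hfib : ∀ i j k : ι, i ≠ j → i ≠ k → j ≠ k → ∀ t s r : κ,
      (#{τ ∈ A | τ i = t ∧ τ j = s ∧ τ k = r} : ℝ) ≤ C := by
    intro i j k hij hik hjk t s r
    set A₃ := conflictFree H (((univ.erase i).erase j).erase k) with hA₃
    have hsub : A ⊆ A₃ := conflictFree_anti H (subset_univ _)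
    have h3 := card_filter_apply_eq_three_mul A₃ hij hik hjk
      (update_mem_conflictFree (by simp)) (update_mem_conflictFree (by simp))
      (update_mem_conflictFree (by simp)) t s r
    have h3' : (#{τ ∈ A₃ | τ i = t ∧ τ j = s ∧ τ k = r} : ℝ) * d ^ 3 = #A₃ := by
      rw [hdd]
      exact_mod_cast h3
    have e1 := card_conflictFree_erase H hsymm hirrH D hdeg hD univ i (mem_univ i)
    have e2 := card_conflictFree_erase H hsymm hirrH D hdeg hD (univ.erase i) j
      (by simp [hij.symm])
    have e3 := card_conflictFree_erase H hsymm hirrH D hdeg hD ((univ.erase i).erase j) k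
      (by simp [hik.symm, hjk.symm])
    have hle : (#{τ ∈ A | τ i = t ∧ τ j = s ∧ τ k = r} : ℝ) ≤
        #{τ ∈ A₃ | τ i = t ∧ τ j = s ∧ τ k = r} := by
      exact_mod_cast card_le_card (filter_subset_filter _ hsub)
    refine hle.trans ?_
    rw [hC, le_div_iff₀ (by positivity), h3']
    linarith
  have htriple : ∀ i j k : ι,
      ∑ τ ∈ A, (if j = k then 0 else ρ (i, τ i) (j, τ j) * ρ (i, τ i) (k, τ k)) ≤
      C * ∑ t, (∑ s, ρ (i, t) (j, s)) * ∑ r, ρ (i, t) (k, r) := by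
    intro i j k
    have hnn : 0 ≤ C * ∑ t, (∑ s, ρ (i, t) (j, s)) * ∑ r, ρ (i, t) (k, r) :=
      mul_nonneg hC0 (sum_nonneg fun t _ => mul_nonneg (sum_nonneg fun _ _ => hρ _ _)
        (sum_nonneg fun _ _ => hρ _ _))
    by_cases hjk : j = k
    · simpa [hjk] using hjk ▸ hnn
    by_cases hij : i = j
    · subst hij
      simpa only [hirr, zero_mul, mul_zero, ite_self, sum_const_zero] using hnn
    by_cases hik : i = k
    · subst hik
      simpa only [hirr, zero_mul, mul_zero, ite_self, sum_const_zero] using hnn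
    have := sum_comp_le_of_card_fiber_le A (fun τ => (τ i, τ j, τ k))
      (fun c => ρ (i, c.1) (j, c.2.1) * ρ (i, c.1) (k, c.2.2))
      (fun c => mul_nonneg (hρ _ _) (hρ _ _)) C (fun c => by
        simpa only [Prod.ext_iff] using hfib i j k hij hik hjk c.1 c.2.1 c.2.2)
    simpa only [Fintype.sum_prod_type, if_neg hjk, sum_mul_sum] using this
  have htotal : ∑ τ ∈ A, ∑ i, ∑ j, ∑ k,
      (if j = k then 0 else ρ (i, τ i) (j, τ j) * ρ (i, τ i) (k, τ k)) ≤
      ∑ τ ∈ A, (1 / 27 : ℝ) := by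
    calc ∑ τ ∈ A, ∑ i, ∑ j, ∑ k,
          (if j = k then 0 else ρ (i, τ i) (j, τ j) * ρ (i, τ i) (k, τ k))
        = ∑ i, ∑ j, ∑ k, ∑ τ ∈ A,
          (if j = k then 0 else ρ (i, τ i) (j, τ j) * ρ (i, τ i) (k, τ k)) := by
          rw [sum_comm]
          refine sum_congr rfl fun i _ => ?_
          rw [sum_comm]
          exact sum_congr rfl fun j _ => sum_comm
      _ ≤ ∑ i, ∑ j, ∑ k, C * ∑ t, (∑ s, ρ (i, t) (j, s)) * ∑ r, ρ (i, t) (k, r) :=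
          sum_le_sum fun i _ => sum_le_sum fun j _ => sum_le_sum fun k _ => htriple i j k
      _ = C * ∑ i, ∑ t, (∑ q, ρ (i, t) q) * ∑ q, ρ (i, t) q := by
          simp only [← mul_sum, Fintype.sum_prod_type]
          congr 1
          refine sum_congr rfl fun i _ => ?_
          rw [sum_congr rfl fun j _ => sum_comm, sum_comm]
          exact sum_congr rfl fun t _ => (sum_mul_sum _ _ _ _).symm
      _ ≤ C * ∑ i : ι, ∑ t : κ, 1 := by
          gcongr with i _ t _
          exact mul_le_one₀ (hsum _) (sum_nonneg fun _ _ => hρ _ _) (hsum _)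
      _ = 64 / 27 * N * (Fintype.card ι / d ^ 2) := by
          simp only [sum_const, card_univ, nsmul_eq_mul, mul_one, ← hdd, hC]
          field_simp
      _ ≤ 64 / 27 * N * (1 / 64) := by
          refine mul_le_mul_of_nonneg_left ?_ (by positivity)
          rw [div_le_iff₀ (by positivity)]
          have : (64 : ℝ) * Fintype.card ι ≤ d ^ 2 := by rw [hdd]; exact_mod_cast hn
          linarith
      _ = ∑ τ ∈ A, (1 / 27 : ℝ) := by
          simp only [sum_const, nsmul_eq_mul, ← hN]
          ring
  obtain ⟨τ, hτA, hτ⟩ := exists_le_of_sum_le hAne htotal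
  refine ⟨τ, hτA, fun i => le_trans (single_le_sum (f := fun i => ∑ j, ∑ k,
    (if j = k then 0 else ρ (i, τ i) (j, τ j) * ρ (i, τ i) (k, τ k)))
    (fun i _ => sum_nonneg fun j _ => sum_nonneg fun k _ => ?_) (mem_univ i)) hτ⟩
  split_ifs
  · exact le_rfl
  · exact mul_nonneg (hρ _ _) (hρ _ _)

/-- A sum of numbers of size at most `1 / 5` whose off-diagonal products sum to at most `1 / 27` is
at most `1 / 3`. -/
lemma sum_le_third_of_sum_mul_le (x : ι → ℝ) (hx0 : ∀ j, 0 ≤ x j) (hx : ∀ j, x j ≤ 1 / 5)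
    (h : ∑ j, ∑ k, (if j = k then 0 else x j * x k) ≤ 1 / 27) : ∑ j, x j ≤ 1 / 3 := by
  by_contra! hlt
  have h1 : ∑ j, ∑ k, (if j = k then 0 else x j * x k) =
      (∑ j, x j) * (∑ j, x j) - ∑ j, x j * x j := by
    rw [sum_mul_sum, ← sum_sub_distrib]
    refine sum_congr rfl fun j _ => ?_
    have h0 : x j * x j = ∑ k, if j = k then x j * x k else 0 := by simp
    rw [eq_sub_iff_add_eq, h0, ← sum_add_distrib]
    exact sum_congr rfl fun k _ => by split_ifs <;> simp
  have h2 : ∑ j, x j * x j ≤ 1 / 5 * ∑ j, x j := by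
    rw [mul_sum]
    exact sum_le_sum fun j _ => mul_le_mul_of_nonneg_right (hx j) (hx0 j)
  rw [h1] at h
  -- For a sum s > 1/3, s(s - 1/5) > 2/45 > 1/27.
  nlinarith

/-- Given weights `ω p q` of the overlap of the bundles `p` and `q` for the owner of `p`, one can
select a bundle for each agent so that everybody loses at most a third when every overlap goes to
the owner who values it more. -/
theorem exists_selection (ω : ι × κ → ι × κ → ℝ)
    (hω : ∀ p q, 0 ≤ ω p q) (hirr : ∀ i t s, ω (i, t) (i, s) = 0) (hsum : ∀ p, ∑ q, ω p q ≤ 1)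
    (hn : 64 * Fintype.card ι ≤ Fintype.card κ ^ 2) :
    ∃ τ : ι → κ, ∀ i, ∑ j, (if ω (i, τ i) (j, τ j) ≤ ω (j, τ j) (i, τ i)
      then ω (i, τ i) (j, τ j) else 0) ≤ 1 / 3 := by
  classical
  have hne : Nonempty (ι → κ) := by
    rcases isEmpty_or_nonempty ι with hι | hι
    · exact ⟨fun i => hι.elim i⟩
    · have h1 : 0 < Fintype.card ι := Fintype.card_pos
      have h2 : 0 < Fintype.card κ := by
        by_contra! h
        rw [Nat.le_zero.1 h] at hn
        omega
      have := Fintype.card_pos_iff.1 h2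
      infer_instance
  set ρ : ι × κ → ι × κ → ℝ := fun p q => if ω p q ≤ ω q p then ω p q else 0 with hρdef
  have hρω : ∀ p q, ρ p q ≤ ω p q := fun p q => by
    simp only [hρdef]; split_ifs; exacts [le_rfl, hω _ _]
  have hρ : ∀ p q, 0 ≤ ρ p q := fun p q => by
    simp only [hρdef]; split_ifs; exacts [hω _ _, le_rfl]
  have hρirr : ∀ i t s, ρ (i, t) (i, s) = 0 := fun i t s => by simp [hρdef, hirr]
  have hρsum : ∀ p, ∑ q, ρ p q ≤ 1 := fun p =>
    (sum_le_sum fun q _ => hρω p q).trans (hsum p)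
  -- If d ≤ 21, then 64n ≤ d² ≤ 21d gives 3n ≤ d; if d ≥ 22, then 16 · 4 ≤ 3d, as conflict degree 4
  -- requires.
  rcases le_or_gt (Fintype.card κ) 21 with hsmall | hlarge
  · exact exists_forall_sum_le_of_three_mul_card_le ρ hρ hρirr hρsum (by nlinarith) hne
  · let H : ι × κ → ι × κ → Prop := fun p q => 1 / 5 < ω p q ∧ 1 / 5 < ω q p
    have hdeg : ∀ p, #{q | H p q} ≤ 4 := by
      intro p
      by_contra! h5
      have h1 : (#{q | H p q} : ℝ) * (1 / 5) < ∑ q ∈ univ.filter (H p), ω p q := by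
        rw [← nsmul_eq_mul, ← sum_const]
        exact sum_lt_sum_of_nonempty (card_pos.1 (by omega)) fun q hq => (mem_filter.1 hq).2.1
      have h2 : ∑ q ∈ univ.filter (H p), ω p q ≤ 1 :=
        (sum_le_sum_of_subset_of_nonneg (subset_univ _) fun q _ _ => hω p q).trans (hsum p)
      have h3 : (5 : ℝ) ≤ #{q | H p q} := by exact_mod_cast h5
      linarith
    obtain ⟨τ, hτ, hle⟩ := exists_conflictFree_sum_le H (fun p q h => ⟨h.2, h.1⟩)
      (by
        rintro ⟨i, t⟩ ⟨j, s⟩ ⟨h, -⟩ (rfl : i = j)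
        rw [hirr] at h
        norm_num at h) 4 hdeg (by omega) ρ hρ hρirr hρsum hn hne
    refine ⟨τ, fun i => sum_le_third_of_sum_mul_le (fun j => ρ (i, τ i) (j, τ j))
      (fun j => hρ _ _) (fun j => ?_) (hle i)⟩
    have hH := mem_conflictFree.1 hτ i (mem_univ i) j (mem_univ j)
    simp only [hρdef]
    split_ifs with hif
    -- A nonzero loss is the smaller of the two fractions, so a loss above 1/5 would be a conflict.
    · by_contra! hlt
      exact hH ⟨hlt, hlt.trans_le hif⟩
    · norm_num

end Transversals

/-! ### Supporting additive functions and shares -/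

section Shares

variable {I : Type*}

/-- An XOS valuation has nonnegative item weights supporting the value of a given set. -/
lemma exists_supporting_weights {v : Finset I → ℝ} (hv : IsValuation v) (hx : IsXOS v)
    (B : Finset I) :
    ∃ w : I → ℝ, (∀ e ∈ B, 0 ≤ w e) ∧ ∑ e ∈ B, w e = v B ∧
      ∀ S : Finset I, ∑ e ∈ S, w e ≤ v S := by
  classical
  obtain ⟨k, a, ha, hmax⟩ := hx
  obtain ⟨l, hl⟩ := (hmax B).1
  have hle : ∀ S : Finset I, ∑ e ∈ S, a l {e} ≤ v S := fun S =>
    (ha l S).symm.le.trans ((hmax S).2 ⟨l, rfl⟩)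
  have heq : ∑ e ∈ B, a l {e} = v B := (ha l B).symm.trans hl
  refine ⟨fun e => a l {e}, fun e he => ?_, heq, hle⟩
  -- A negative weight in `B` would make the weights of `B.erase e` exceed `v B`, against
  -- monotonicity.
  have h1 := Finset.add_sum_erase B (fun e => a l {e}) he
  have h2 := hle (B.erase e)
  have h3 := hv.2 _ _ (B.erase_subset e)
  linarith

lemma IsMMSPartition.maximinShare_le {d : ℕ} {v : Finset I → ℝ} {P : Fin d → Finset I}
    (hP : IsMMSPartition v P) (t : Fin d) : maximinShare v d ≤ v (P t) := by
  have : Nonempty {Q : Fin d → Finset I // IsPartition Q} := ⟨⟨P, hP.1⟩⟩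
  exact (ciSup_le fun Q : {Q : Fin d → Finset I // IsPartition Q} => hP.2 Q.1 Q.2).trans
    (ciInf_le (Set.finite_range _).bddBelow t)

end Shares

/-! ### Canonical bundles -/

section Bundles

variable {α β : Type*}

/-- Non-incident edges can be removed one at a time, so canonical bundles inherit the maximin
guarantee of the parts. -/
lemma IsGraphical.apply_canonicalBundle {G : Graph α β} {v : V(G) → Finset E(G) → ℝ}
    (hv : IsGraphical G v) (i : V(G)) (S : Finset E(G)) :
    v i (canonicalBundle G i S) = v i S := by
  classical
  have key : ∀ T : Finset E(G), (∀ f ∈ T, ¬ G.Inc f i) →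
      ∀ U : Finset E(G), v i (T ∪ U) = v i U := by
    intro T
    induction T using Finset.induction_on with
    | empty => simp
    | insert f T _ ihT =>
      intro hT U
      have h1 := hv i f (hT f (Finset.mem_insert_self f T)) (T ∪ U)
      rw [Finset.insert_union, ← ihT (fun g hg => hT g (Finset.mem_insert_of_mem hg)) U, ← h1]
      congr!
  rw [← key (S.filter fun e => ¬ G.Inc e i) (fun f hf => (Finset.mem_filter.1 hf).2)
    (canonicalBundle G i S)]
  congr 1
  ext e
  simp only [canonicalBundle, Finset.mem_union, Finset.mem_filter]
  tauto

lemma mem_canonicalBundle {G : Graph α β} {i : V(G)} {S : Finset E(G)} {e : E(G)} :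
    e ∈ canonicalBundle G i S ↔ e ∈ S ∧ G.Inc e i := by
  classical
  simp [canonicalBundle]

/-- An edge has no three distinct ends. -/
lemma eq_of_inc_of_inc_of_inc {G : Graph α β} {e : E(G)} {i j k : V(G)} (hi : G.Inc e i)
    (hj : G.Inc e j) (hk : G.Inc e k) (hij : i ≠ j) (hik : i ≠ k) : j = k := by
  rcases hi.eq_or_eq_or_eq hj hk with h | h | h
  · exact absurd (Subtype.ext h) hij
  · exact absurd (Subtype.ext h) hik
  · exact Subtype.ext h

/-- The overlaps of a canonical bundle with those of the other agents are pairwise disjoint. -/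
lemma pairwiseDisjoint_inter_canonicalBundle {G : Graph α β} [DecidableEq E(G)] {d : ℕ}
    {P : V(G) → Fin d → Finset E(G)} (hP : ∀ i, IsPartition (P i)) (i : V(G)) (S : Finset E(G)) :
    {q : V(G) × Fin d | i ≠ q.1}.PairwiseDisjoint
      fun q => canonicalBundle G i S ∩ canonicalBundle G q.1 (P q.1 q.2) := by
  rintro ⟨j, s⟩ hj ⟨k, r⟩ hk hne
  refine Finset.disjoint_left.2 fun e he he' => hne ?_
  simp only [Finset.mem_inter, mem_canonicalBundle] at he he'
  obtain rfl : j = k := eq_of_inc_of_inc_of_inc he.1.2 he.2.2 he'.2.2 hj hk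
  by_contra hsr
  exact Finset.disjoint_left.1 ((hP j).1 s r fun h => hsr (by rw [h])) he.2.1 he'.2.1

/-- Every partial orientation extends to an orientation of all edges. -/
lemma IsPartialOrientation.exists_isOrientation {G : Graph α β} [Fintype E(G)]
    {X : V(G) → Finset E(G)} (hX : IsPartialOrientation G X) :
    ∃ Y : V(G) → Finset E(G), IsOrientation G Y ∧ ∀ i, X i ⊆ Y i := by
  classical
  have hend : ∀ e : E(G), ∃ i : V(G), G.Inc e i := fun e => by
    obtain ⟨x, y, h⟩ := Graph.exists_isLink_of_mem_edgeSet e.2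
    exact ⟨⟨x, h.left_mem⟩, h.inc_left⟩
  have howner : ∀ e : E(G), ∃ i : V(G), G.Inc e i ∧ ∀ j, e ∈ X j → j = i := fun e => by
    by_cases h : ∃ i, e ∈ X i
    · obtain ⟨i, hi⟩ := h
      refine ⟨i, hX.2 i e hi, fun j hj => ?_⟩
      by_contra hji
      exact Finset.disjoint_left.1 (hX.1 j i hji) hj hi
    · obtain ⟨i, hi⟩ := hend e
      exact ⟨i, hi, fun j hj => absurd ⟨j, hj⟩ h⟩
  choose o ho hoX using howner
  refine ⟨fun i => Finset.univ.filter fun e => o e = i, ⟨⟨fun i j hij => ?_, fun i e he => ?_⟩,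
    fun e => ⟨o e, by simp⟩⟩, fun i e he => by simp [hoX e i he]⟩
  · refine Finset.disjoint_left.2 fun e he he' => hij ?_
    rw [← (Finset.mem_filter.1 he).2, (Finset.mem_filter.1 he').2]
  · rw [← (Finset.mem_filter.1 he).2]
    exact ho e

end Bundles

end FairGraph

/-! ### Assembling the orientation -/

theorem mainTheorem6 {α β : Type*} (G : Graph α β) [Fintype V(G)] [Fintype E(G)]
    (v : V(G) → Finset E(G) → ℝ)
    (hval : ∀ i, FairGraph.IsValuation (v i))
    (hXOS : ∀ i, FairGraph.IsXOS (v i))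
    (hgraph : FairGraph.IsGraphical G v)
    (d : ℕ) (hd : d = ⌈8 * √(Fintype.card V(G) : ℝ)⌉₊)
    (P : V(G) → Fin d → Finset E(G))
    (hP : ∀ i, FairGraph.IsMMSPartition (v i) (P i)) :
    ∃ X : V(G) → Finset E(G),
      FairGraph.IsPartialOrientation G X ∧
      FairGraph.IsFrugal G P X ∧
      FairGraph.IsOutOfMMS G v (2 / 3) d X ∧
      ∃ Y : V(G) → Finset E(G),
        FairGraph.IsOrientation G Y ∧ (∀ i, X i ⊆ Y i) ∧
        FairGraph.IsOutOfMMS G v (2 / 3) d Y := by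
  classical
  have hn : 64 * Fintype.card V(G) ≤ Fintype.card (Fin d) ^ 2 := by
    have h1 : 8 * √(Fintype.card V(G) : ℝ) ≤ d := hd ▸ Nat.le_ceil _
    have h2 := Real.sq_sqrt (Nat.cast_nonneg (α := ℝ) (Fintype.card V(G)))
    have h3 : (64 : ℝ) * Fintype.card V(G) ≤ (d : ℝ) ^ 2 := by
      nlinarith [Real.sqrt_nonneg (Fintype.card V(G) : ℝ)]
    rw [Fintype.card_fin]
    exact_mod_cast h3
  let B : V(G) × Fin d → Finset E(G) := fun q => FairGraph.canonicalBundle G q.1 (P q.1 q.2)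
  have hpart : ∀ i, FairGraph.IsPartition (P i) := fun i => (hP i).1
  choose w hw0 hwB hwle using fun p : V(G) × Fin d =>
    FairGraph.exists_supporting_weights (hval p.1) (hXOS p.1) (B p)
  have hv0 : ∀ i S, 0 ≤ v i S := fun i S => (hval i).1 ▸ (hval i).2 ∅ S (Finset.empty_subset S)
  have hdisj : ∀ p, {q : V(G) × Fin d | p.1 ≠ q.1}.PairwiseDisjoint fun q => B p ∩ B q :=
    fun p => FairGraph.pairwiseDisjoint_inter_canonicalBundle hpart p.1 (P p.1 p.2)
  -- For a worthless bundle the division by zero gives 0, so the bounds on `ω` still hold.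
  let ω : V(G) × Fin d → V(G) × Fin d → ℝ := fun p q =>
    if p.1 ≠ q.1 then (∑ e ∈ B p ∩ B q, w p e) / v p.1 (B p) else 0
  have hω : ∀ p q, 0 ≤ ω p q := fun p q => by
    simp only [ω]
    split_ifs
    · exact div_nonneg
        (Finset.sum_nonneg fun e he => hw0 p e (Finset.mem_inter.1 he).1) (hv0 _ _)
    · exact le_rfl
  have hωsum : ∀ p, ∑ q, ω p q ≤ 1 := fun p => by
    simp only [ω]
    rw [← Finset.sum_filter, ← Finset.sum_div, ← Finset.sum_biUnion fun q hq r hr hqr =>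
      hdisj p (by simpa using hq) (by simpa using hr) hqr]
    refine div_le_one_of_le₀ ?_ (hv0 _ _)
    rw [← hwB p]
    refine Finset.sum_le_sum_of_subset_of_nonneg (fun e he => ?_) fun e he _ => hw0 p e he
    obtain ⟨q, -, hq⟩ := Finset.mem_biUnion.1 he
    exact (Finset.mem_inter.1 hq).1
  obtain ⟨τ, hτ⟩ := FairGraph.exists_selection ω hω (fun i t s => by simp [ω]) hωsum hn
  -- On a tie both agents give up the overlap; such edges are assigned only in `Y`.
  let X : V(G) → Finset E(G) := fun i => (B (i, τ i)).filter fun e =>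
    ∀ j, i ≠ j → ω (i, τ i) (j, τ j) ≤ ω (j, τ j) (i, τ i) → e ∉ B (j, τ j)
  have hXB : ∀ i, X i ⊆ B (i, τ i) := fun i => Finset.filter_subset _ _
  have hXo : FairGraph.IsPartialOrientation G X := by
    refine ⟨fun i j hij => Finset.disjoint_left.2 fun e he he' => ?_, fun i e he =>
      (FairGraph.mem_canonicalBundle.1 (hXB i he)).2⟩
    rcases le_total (ω (i, τ i) (j, τ j)) (ω (j, τ j) (i, τ i)) with h | h
    · exact (Finset.mem_filter.1 he).2 j hij h (hXB j he')
    · exact (Finset.mem_filter.1 he').2 i hij.symm h (hXB i he)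
  have hXv : FairGraph.IsOutOfMMS G v (2 / 3) d X := by
    intro i
    have hμ : FairGraph.maximinShare (v i) d ≤ v i (B (i, τ i)) :=
      ((hP i).maximinShare_le (τ i)).trans_eq (hgraph.apply_canonicalBundle i _).symm
    rcases (hv0 i (B (i, τ i))).eq_or_lt with hB | hB
    · have := hv0 i (X i)
      linarith
    let J : Finset V(G) := {j | i ≠ j ∧ ω (i, τ i) (j, τ j) ≤ ω (j, τ j) (i, τ i)}
    have hcover : B (i, τ i) \ X i ⊆ J.biUnion fun j => B (i, τ i) ∩ B (j, τ j) := by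
      intro e he
      rw [Finset.mem_sdiff] at he
      have h : ∃ j, i ≠ j ∧ ω (i, τ i) (j, τ j) ≤ ω (j, τ j) (i, τ i) ∧ e ∈ B (j, τ j) := by
        by_contra! h
        exact he.2 (Finset.mem_filter.2 ⟨he.1, h⟩)
      obtain ⟨j, hij, hle, hj⟩ := h
      exact Finset.mem_biUnion.2 ⟨j, by simp [J, hij, hle], Finset.mem_inter.2 ⟨he.1, hj⟩⟩
    have hloss : ∑ e ∈ B (i, τ i) \ X i, w (i, τ i) e ≤ 1 / 3 * v i (B (i, τ i)) := by
      calc ∑ e ∈ B (i, τ i) \ X i, w (i, τ i) e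
          ≤ ∑ e ∈ J.biUnion fun j => B (i, τ i) ∩ B (j, τ j), w (i, τ i) e := by
            refine Finset.sum_le_sum_of_subset_of_nonneg hcover fun e he _ => ?_
            obtain ⟨j, -, hj⟩ := Finset.mem_biUnion.1 he
            exact hw0 _ e (Finset.mem_inter.1 hj).1
        _ = ∑ j ∈ J, ∑ e ∈ B (i, τ i) ∩ B (j, τ j), w (i, τ i) e :=
            Finset.sum_biUnion fun j hj k hk hjk => hdisj (i, τ i)
              (Finset.mem_filter.1 hj).2.1 (Finset.mem_filter.1 hk).2.1
              fun h => hjk (congrArg Prod.fst h)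
        _ = ∑ j ∈ J, ω (i, τ i) (j, τ j) * v i (B (i, τ i)) := by
            refine Finset.sum_congr rfl fun j hj => ?_
            simp only [ω]
            rw [if_pos (Finset.mem_filter.1 hj).2.1, div_mul_cancel₀ _ hB.ne']
        _ ≤ (∑ j, if ω (i, τ i) (j, τ j) ≤ ω (j, τ j) (i, τ i)
              then ω (i, τ i) (j, τ j) else 0) * v i (B (i, τ i)) := by
            rw [← Finset.sum_mul, ← Finset.sum_filter (fun j =>
              ω (i, τ i) (j, τ j) ≤ ω (j, τ j) (i, τ i)) fun j => ω (i, τ i) (j, τ j)]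
            refine mul_le_mul_of_nonneg_right (Finset.sum_le_sum_of_subset_of_nonneg
              (fun j hj => ?_) fun j _ _ => hω _ _) hB.le
            exact Finset.mem_filter.2 ⟨Finset.mem_univ j, (Finset.mem_filter.1 hj).2.2⟩
        _ ≤ 1 / 3 * v i (B (i, τ i)) := mul_le_mul_of_nonneg_right (hτ i) hB.le
    -- The supporting weights equal `v i` on the bundle and bound it from below on `X i`, so losing
    -- a third of the weight leaves two thirds of the value.
    have hsplit := Finset.sum_sdiff (f := w (i, τ i)) (hXB i)
    have hB' := hwB (i, τ i)
    have hX' := hwle (i, τ i) (X i)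
    dsimp only at hB' hX'
    linarith
  obtain ⟨Y, hY, hXY⟩ := hXo.exists_isOrientation
  exact ⟨X, hXo, fun i => ⟨τ i, hXB i⟩, hXv, Y, hY, hXY,
    fun i => (hXv i).trans ((hval i).2 _ _ (hXY i))⟩
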